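/- Theorem (Bon-Yau Chu). Let $G$ be a (smooth, finite-dimensional) real semisimple Lie group of positive dimension, i.e. the Lie algebra $\mathfrak g\neq 0$ of $G$ is a direct sum of simple Lie algebras. Then $G$ does not admit a left-invariant flat affine connection: there is no smooth linear connection $\nabla$ on the tangent bundle $TG$ such that, for all smooth vector fields $X,Y,Z$ on $G$ and all $\sigma\in G$ (with $L_\sigma(\tau)=\sigma\tau$), $$(L_{\sigma^{-1}})_*\big(\nabla_{(L_\sigma)_*X}(L_\sigma)_*Y\big)=\nabla_XY,\qquad \nabla_XY-\nabla_YX-[X,Y]=0,\qquad \nabla_X\nabla_YZ-\nabla_Y\nabla_XZ-\nabla_{[X,Y]}Z=0 .$$ -/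

import Mathlib

open scoped Manifold ContDiff

noncomputable section

/-- A finite-dimensional real normed space is complete. -/
instance instCompleteSpaceOfFiniteDimensionalReal (E : Type*) [NormedAddCommGroup E]
    [NormedSpace ℝ E] [FiniteDimensional ℝ E] : CompleteSpace E :=
  FiniteDimensional.complete ℝ E

/-- A smooth real Lie group has the finite regularity under which Mathlib builds the Lie algebra
structure on the tangent space at the identity. -/
instance instLieGroupMinSmoothnessThree {E : Type*} [NormedAddCommGroup E] [NormedSpace ℝ E]
    {H : Type*} [TopologicalSpace H] {I : ModelWithCorners ℝ E H}
    {G : Type*} [TopologicalSpace G] [ChartedSpace H G] [Group G] [LieGroup I ∞ G] :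
    LieGroup I (minSmoothness ℝ 3) G :=
  LieGroup.of_le (n := ∞) (by
    rw [minSmoothness_of_isRCLikeNormedField]
    exact ENat.LEInfty.out)

section Connection

variable {E : Type*} [NormedAddCommGroup E] [NormedSpace ℝ E]
  {H : Type*} [TopologicalSpace H] {I : ModelWithCorners ℝ E H}
  {M : Type*} [TopologicalSpace M] [ChartedSpace H M]

/-- The vector field `X` on `M` is smooth, that is, `C^∞`. -/
def IsSmoothVectorField [IsManifold I ∞ M] (X : Π x : M, TangentSpace I x) : Prop :=
  ContMDiff I I.tangent ∞ (fun x ↦ (⟨x, X x⟩ : TangentBundle I M))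

namespace CovariantDerivative

/-- The vector field `∇_X Y`. -/
def along [IsManifold I ∞ M] (cov : CovariantDerivative I E (TangentSpace I : M → Type _))
    (X Y : Π x : M, TangentSpace I x) : Π x : M, TangentSpace I x :=
  fun x ↦ cov Y x (X x)

/-- The curvature `R(X, Y) Z = ∇_X ∇_Y Z - ∇_Y ∇_X Z - ∇_[X, Y] Z` of a connection `∇` on the
tangent bundle. -/
def curvature [IsManifold I ∞ M] (cov : CovariantDerivative I E (TangentSpace I : M → Type _))
    (X Y Z : Π x : M, TangentSpace I x) : Π x : M, TangentSpace I x :=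
  cov.along X (cov.along Y Z) - cov.along Y (cov.along X Z)
    - cov.along (VectorField.mlieBracket I X Y) Z

/-- A flat affine connection: a smooth connection on the tangent bundle whose torsion tensor and
curvature tensor both vanish. -/
structure IsFlatAffine [FiniteDimensional ℝ E] [IsManifold I ∞ M]
    (cov : CovariantDerivative I E (TangentSpace I : M → Type _)) : Prop where
  smooth : ContMDiffCovariantDerivative cov ∞
  torsion_eq_zero : cov.torsion = 0
  curvature_eq_zero : ∀ X Y Z : Π x : M, TangentSpace I x,
    IsSmoothVectorField X → IsSmoothVectorField Y → IsSmoothVectorField Z →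
      cov.curvature X Y Z = 0

end CovariantDerivative

end Connection

section LieGroup

variable {E : Type*} [NormedAddCommGroup E] [NormedSpace ℝ E]
  {H : Type*} [TopologicalSpace H] {I : ModelWithCorners ℝ E H}
  {G : Type*} [TopologicalSpace G] [ChartedSpace H G] [Group G]

/-- The pushforward `(L_σ)_* X` of a vector field `X` under the left translation `L_σ`, written as
the pullback of `X` under the inverse diffeomorphism `L_{σ⁻¹}`. -/
def leftPushforward (σ : G) (X : Π τ : G, TangentSpace I τ) : Π τ : G, TangentSpace I τ :=
  VectorField.mpullback I I (fun τ ↦ σ⁻¹ * τ) X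

/-- The connection is left invariant: every left translation `L_σ` is an affine transformation,
`(L_{σ⁻¹})_* (∇_{(L_σ)_* X} (L_σ)_* Y) = ∇_X Y` for all smooth vector fields `X`, `Y`. -/
def CovariantDerivative.IsLeftInvariant [LieGroup I ∞ G]
    (cov : CovariantDerivative I E (TangentSpace I : G → Type _)) : Prop :=
  ∀ (σ : G) (X Y : Π τ : G, TangentSpace I τ), IsSmoothVectorField X → IsSmoothVectorField Y →
    leftPushforward σ⁻¹ (cov.along (leftPushforward σ X) (leftPushforward σ Y)) = cov.along X Y

variable (I G) in
/-- A smooth real Lie group is semisimple if its Lie algebra is, that is, if its Lie algebra is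
the direct sum of its minimal ideals and these are simple. -/
def IsSemisimpleLieGroup [FiniteDimensional ℝ E] [LieGroup I ∞ G] : Prop :=
  LieAlgebra.IsSemisimple ℝ (GroupLieAlgebra I G)

end LieGroup

end

/-! ### Semisimple Lie algebras have no bijective 1-cocycle. -/

namespace LieAlgebra

open Module

attribute [local instance] LieRing.ofAssociativeRing

variable {K L M : Type*} [Field K] [LieRing L] [LieAlgebra K L] [AddCommGroup M] [Module K M]
  [LieRingModule L M] [LieModule K L M]

/-! On left-invariant fields, `∇` becomes a bilinear product on the Lie algebra: flatness makes left
multiplication a representation, and zero torsion makes the identity map a 1-cocycle for it. For a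
semisimple `L` a bijective cocycle `f` into a module `M` is impossible. It forces `M` to be
faithful, so by Cartan's criterion the trace form is nondegenerate, and its Casimir operator on `M`
has trace `dim L`. The cocycle identity writes this operator as the action of some `a` in `L` minus
a conjugate of `ad a`. Both have trace zero because `L` is perfect, so `dim L = 0`. -/

/-- A semisimple Lie algebra is perfect. -/
theorem derivedSeries_one_eq_top_of_isSemisimple [IsSemisimple K L] :
    derivedSeries K L 1 = ⊤ := by
  obtain ⟨J, hJ⟩ := exists_isCompl (derivedSeries K L 1)
  have hJJ : ⁅J, J⁆ = ⊥ := by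
    rw [eq_bot_iff, ← hJ.inf_eq_bot]
    exact le_inf (LieSubmodule.mono_lie le_top le_top) (LieSubmodule.lie_le_right J J)
  have : IsLieAbelian J := (LieSubmodule.lie_abelian_iff_lie_self_eq_bot J).mpr hJJ
  have hJ_bot : J = ⊥ := HasTrivialRadical.eq_bot_of_isSolvable J
  simpa [hJ_bot] using hJ.sup_eq_top

/-- Every element of a semisimple Lie algebra acts with trace zero. -/
theorem trace_toEnd_eq_zero_of_isSemisimple [IsSemisimple K L] (x : L) :
    LinearMap.trace K M (LieModule.toEnd K L M x) = 0 := by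
  refine LieModule.trace_toEnd_eq_zero_of_mem_lcs K L M (k := 1) le_rfl ?_
  change x ∈ derivedSeries K L 1
  rw [derivedSeries_one_eq_top_of_isSemisimple]
  trivial

/-- A Lie algebra with a faithful representation whose trace form vanishes is solvable. -/
theorem isSolvable_of_traceForm_eq_zero [CharZero K] [FiniteDimensional K L]
    [FiniteDimensional K M] (hM : Function.Injective (LieModule.toEnd K L M))
    (h : LieModule.traceForm K L M = 0) : IsSolvable L := by
  have hnil := LieModule.isNilpotent_derivedSeries_of_traceForm_eq_zero h
  rw [LieModule.isNilpotent_iff_forall' (R := K)] at hnil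
  -- Elements of the derived ideal act nilpotently on `M`, hence so do their commutators on `End K
  -- M`; faithfulness carries this back to `ad`, and Engel's theorem applies.
  have : LieRing.IsNilpotent (derivedSeries K L 1) := by
    rw [LieAlgebra.isNilpotent_iff_forall (R := K)]
    intro x
    obtain ⟨n, hn⟩ := LieAlgebra.ad_nilpotent_of_nilpotent (R := K) (hnil x)
    refine ⟨n, LinearMap.ext fun y ↦ Subtype.ext (hM ?_)⟩
    have key : ∀ k : ℕ, LieModule.toEnd K L M ((((ad K (derivedSeries K L 1) x) ^ k) y : L)) =
        ((ad K (End K M) (LieModule.toEnd K L M x)) ^ k) (LieModule.toEnd K L M y) := by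
      intro k
      induction k with
      | zero => rfl
      | succ k ih =>
        rw [pow_succ', pow_succ', Module.End.mul_apply, Module.End.mul_apply, ← ih]
        simp
    rw [key n]
    have hn' : (ad K (End K M) (LieModule.toEnd K L M x)) ^ n = 0 := hn
    rw [hn']
    simp
  obtain ⟨k, hk⟩ := IsSolvable.solvable K (derivedSeries K L 1)
  rw [LieIdeal.derivedSeries_eq_bot_iff] at hk
  refine IsSolvable.mk (R := K) (k := k + 1) ?_
  change derivedSeriesOfIdeal K L (k + 1) ⊤ = ⊥
  rw [derivedSeriesOfIdeal_add]
  exact hk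

/-- The trace form of a faithful representation of a semisimple Lie algebra is nondegenerate. -/
theorem traceForm_nondegenerate_of_injective_toEnd [CharZero K] [FiniteDimensional K L]
    [FiniteDimensional K M] [HasTrivialRadical K L]
    (hM : Function.Injective (LieModule.toEnd K L M)) :
    (LieModule.traceForm K L M).Nondegenerate := by
  -- The radical of the form is an ideal on which the form vanishes, hence solvable.
  let I : LieIdeal K L := InvariantForm.orthogonal (LieModule.traceForm K L M)
    (LieModule.traceForm_lieInvariant K L M) ⊤
  have hI : IsSolvable I := by
    refine isSolvable_of_traceForm_eq_zero (K := K) (M := M)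
      (fun x y hxy ↦ Subtype.ext (hM hxy)) ?_
    ext x y
    exact y.2 x trivial
  have hI_bot : I = ⊥ := HasTrivialRadical.eq_bot_of_isSolvable I
  refine (LinearMap.IsRefl.nondegenerate_iff_separatingRight
    (LieModule.traceForm_isSymm K L M).isRefl).mpr ?_
  intro y hy
  have : y ∈ I := fun x _ ↦ hy x
  rwa [hI_bot] at this

/-- A Lie algebra all of whose abelian ideals vanish acts faithfully through any representation
that admits an injective 1-cocycle. -/
theorem injective_toEnd_of_injective_cocycle [HasTrivialRadical K L] (f : L →ₗ[K] M)
    (hf : Function.Injective f) (hcoc : ∀ x y : L, f ⁅x, y⁆ = ⁅x, f y⁆ - ⁅y, f x⁆) :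
    Function.Injective (LieModule.toEnd K L M) := by
  have hI : IsLieAbelian (LieModule.toEnd K L M).ker := by
    refine ⟨fun x y ↦ Subtype.ext (hf ?_)⟩
    have hx : ∀ m : M, ⁅(x : L), m⁆ = 0 := LinearMap.congr_fun x.2
    have hy : ∀ m : M, ⁅(y : L), m⁆ = 0 := LinearMap.congr_fun y.2
    simp [hcoc, hx, hy]
  exact (LieHom.ker_eq_bot _).mp (HasTrivialRadical.eq_bot_of_isSolvable _)

/-- Given dual bases for an invariant form, the element `∑ bᵢ ⊗ b'ᵢ` is invariant. -/
theorem sum_lie_dualBasis_eq_zero {ι V : Type*} [Fintype ι] [DecidableEq ι] [AddCommGroup V]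
    [Module K V] {B : LinearMap.BilinForm K L} (hB : B.Nondegenerate) (hsymm : B.IsSymm)
    (hinv : B.lieInvariant L) (b : Module.Basis ι K L) (g : L →ₗ[K] L →ₗ[K] V) (x : L) :
    ∑ i, (g ⁅x, b i⁆ (B.dualBasis hB b i) + g (b i) ⁅x, B.dualBasis hB b i⁆) = 0 := by
  set b' := B.dualBasis hB b with hb'
  have h₁ : ∀ i, ⁅x, b i⁆ = ∑ j, B ⁅x, b i⁆ (b' j) • b j := fun i ↦ by
    conv_lhs => rw [← b.sum_repr ⁅x, b i⁆]
    refine Finset.sum_congr rfl fun j _ ↦ ?_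
    rw [← LinearMap.BilinForm.dualBasis_dualBasis hB hsymm b,
      LinearMap.BilinForm.dualBasis_repr_apply, LinearMap.BilinForm.dualBasis_dualBasis hB hsymm b]
  have h₂ : ∀ i, ⁅x, b' i⁆ = ∑ j, B ⁅x, b' i⁆ (b j) • b' j := fun i ↦ by
    conv_lhs => rw [← b'.sum_repr ⁅x, b' i⁆]
    simp [hb']
  rw [Finset.sum_add_distrib]
  have e₁ : ∑ i, g ⁅x, b i⁆ (b' i) = ∑ i, ∑ j, B ⁅x, b i⁆ (b' j) • g (b j) (b' i) := by
    refine Finset.sum_congr rfl fun i _ ↦ ?_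
    conv_lhs => rw [h₁ i]
    simp
  have e₂ : ∑ i, g (b i) ⁅x, b' i⁆ = ∑ i, ∑ j, B ⁅x, b' i⁆ (b j) • g (b i) (b' j) := by
    refine Finset.sum_congr rfl fun i _ ↦ ?_
    conv_lhs => rw [h₂ i]
    simp
  rw [e₁, e₂, Finset.sum_comm, ← Finset.sum_add_distrib]
  refine Finset.sum_eq_zero fun i _ ↦ ?_
  rw [← Finset.sum_add_distrib]
  refine Finset.sum_eq_zero fun j _ ↦ ?_
  -- Invariance and symmetry make the two coefficients of `g (b i) (b' j)` opposite.
  rw [← add_smul, hinv x (b j), hsymm.eq (b j)]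
  simp

/-- A nonzero semisimple Lie algebra in characteristic zero has no bijective 1-cocycle. -/
theorem not_exists_bijective_cocycle [CharZero K] [FiniteDimensional K L] [Nontrivial L]
    [IsSemisimple K L] (f : L ≃ₗ[K] M) :
    ¬ ∀ x y : L, f ⁅x, y⁆ = ⁅x, f y⁆ - ⁅y, f x⁆ := by
  classical
  intro hcoc
  have : FiniteDimensional K M := f.finiteDimensional
  have hB := traceForm_nondegenerate_of_injective_toEnd
    (injective_toEnd_of_injective_cocycle f.toLinearMap f.injective hcoc)
  have hsymm : (LieModule.traceForm K L M).IsSymm :=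
    LinearMap.BilinForm.isSymm_iff.mpr <| LieModule.traceForm_isSymm K L M
  let b := Module.finBasis K L
  let b' := LinearMap.BilinForm.dualBasis _ hB b
  let φ := LieModule.toEnd K L M
  let casimir : End K M := ∑ i, φ (b i) * φ (b' i)
  -- If `f` were the coboundary `x ↦ ⁅x, m⁆`, this would be `casimir m`.
  let e : M := ∑ i, ⁅b i, f (b' i)⁆
  have h_casimir : ∀ x, ⁅x, e⁆ = casimir (f x) := by
    intro x
    let g : L →ₗ[K] L →ₗ[K] M := (φ : L →ₗ[K] End K M).compl₂ f.toLinearMap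
    have hg := sum_lie_dualBasis_eq_zero hB hsymm
      (LieModule.traceForm_lieInvariant K L M) b g x
    have : ⁅x, e⁆ - casimir (f x) = ∑ i, (g ⁅x, b i⁆ (b' i) + g (b i) ⁅x, b' i⁆) := by
      simp only [e, casimir, lie_sum, LinearMap.sum_apply, ← Finset.sum_sub_distrib]
      refine Finset.sum_congr rfl fun i _ ↦ ?_
      change ⁅x, ⁅b i, f (b' i)⁆⁆ - ⁅b i, ⁅b' i, f x⁆⁆ =
        ⁅⁅x, b i⁆, f (b' i)⁆ + ⁅b i, f ⁅x, b' i⁆⁆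
      rw [hcoc, lie_sub, leibniz_lie x (b i)]
      abel
    rw [hg] at this
    exact sub_eq_zero.mp this
  have tr_casimir : LinearMap.trace K M casimir = finrank K L := by
    have : ∀ i, LinearMap.trace K M (φ (b i) * φ (b' i)) = 1 := fun i ↦ by
      have := LinearMap.BilinForm.apply_dualBasis_right hB hsymm b i i
      simpa [LieModule.traceForm_apply_apply] using! this
    simp [casimir, map_sum, this]
  -- This is the cocycle identity at `x` and `f.symm e`, with `⁅x, e⁆` replaced by `casimir (f x)`.
  have h_eq : casimir = φ (f.symm e) - f.conj (ad K L (f.symm e)) := by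
    ext m
    obtain ⟨x, rfl⟩ := f.surjective m
    have := hcoc x (f.symm e)
    rw [f.apply_symm_apply, h_casimir] at this
    simp only [LinearMap.sub_apply, LinearEquiv.conj_apply_apply, f.symm_apply_apply, ad_apply]
    rw [← lie_skew, map_neg, this]
    change _ = ⁅_, _⁆ - _
    abel
  have h₁ : LinearMap.trace K M (φ (f.symm e)) = 0 := trace_toEnd_eq_zero_of_isSemisimple _
  have h₂ : LinearMap.trace K L (ad K L (f.symm e)) = 0 := trace_toEnd_eq_zero_of_isSemisimple _
  rw [h_eq, map_sub, LinearMap.trace_conj', h₁, h₂, sub_zero] at tr_casimir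
  exact finrank_pos.ne' (Nat.cast_eq_zero.mp tr_casimir.symm)

/-- A nonzero semisimple Lie algebra in characteristic zero carries no compatible left-symmetric
product. -/
theorem not_exists_leftSymmetric_product [CharZero K] [FiniteDimensional K L] [Nontrivial L]
    [IsSemisimple K L] (p : L →ₗ[K] L →ₗ[K] L)
    (hp : ∀ x y z : L, p ⁅x, y⁆ z = p x (p y z) - p y (p x z)) :
    ¬ ∀ x y : L, p x y - p y x = ⁅x, y⁆ := by
  intro hp'
  let φ : L →ₗ⁅K⁆ End K L := { p with map_lie' := fun {x y} ↦ LinearMap.ext (hp x y) }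
  -- `L` must act on itself through `p`, not through the adjoint action, so this instance is passed
  -- explicitly.
  let mod : LieRingModule L L := LieRingModule.compLieHom L φ
  have lmod : @LieModule K L L _ _ _ _ _ mod := LieModule.compLieHom L φ
  refine @not_exists_bijective_cocycle K L L _ _ _ _ _ mod lmod _ _ _ _
    (LinearEquiv.refl K L) fun x y ↦ ?_
  exact (hp' x y).symm

end LieAlgebra

/-! ### From invariant connections to products on the Lie algebra. -/

section LieGroup

open Bundle Function

variable {E : Type*} [NormedAddCommGroup E] [NormedSpace ℝ E]
  {H : Type*} [TopologicalSpace H] {I : ModelWithCorners ℝ E H}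
  {G : Type*} [TopologicalSpace G] [ChartedSpace H G] [Group G]

theorem mulInvariantVectorField_apply_one (v : GroupLieAlgebra I G) :
    mulInvariantVectorField v (1 : G) = v := by
  have h : HasMFDerivAt I I (fun x : G ↦ 1 * x) 1 (ContinuousLinearMap.id ℝ (TangentSpace I 1)) :=
    (hasMFDerivAt_id (1 : G)).congr_of_eventuallyEq (.of_forall one_mul)
  exact DFunLike.congr_fun h.mfderiv v

variable [LieGroup I ∞ G]

/-- Left-invariant vector fields on a smooth Lie group are smooth. -/
theorem isSmoothVectorField_mulInvariantVectorField (v : GroupLieAlgebra I G) :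
    IsSmoothVectorField (mulInvariantVectorField v : Π g : G, TangentSpace I g) := by
  -- The field at `g` is the derivative of multiplication at `(g, 1)` applied to `(0, v)`.
  let fg : G → TangentBundle I G := fun g ↦ TotalSpace.mk' E g 0
  have sfg : ContMDiff I I.tangent ∞ fg := contMDiff_zeroSection _ _
  let fv : G → TangentBundle I G := fun _ ↦ TotalSpace.mk' E 1 v
  have sfv : ContMDiff I I.tangent ∞ fv := contMDiff_const
  let F₁ : G → (TangentBundle I G × TangentBundle I G) := fun g ↦ (fg g, fv g)
  have S₁ : ContMDiff I (I.tangent.prod I.tangent) ∞ F₁ := sfg.prodMk sfv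
  let F₂ : (TangentBundle I G × TangentBundle I G) → TangentBundle (I.prod I) (G × G) :=
    (equivTangentBundleProd I G I G).symm
  have S₂ : ContMDiff (I.tangent.prod I.tangent) (I.prod I).tangent ∞ F₂ :=
    contMDiff_equivTangentBundleProd_symm
  let F₃ : TangentBundle (I.prod I) (G × G) → TangentBundle I G :=
    tangentMap (I.prod I) I (fun p : G × G ↦ p.1 * p.2)
  have S₃ : ContMDiff (I.prod I).tangent I.tangent ∞ F₃ :=
    (contMDiff_mul I ∞).contMDiff_tangentMap le_rfl
  let S := (S₃.comp S₂).comp S₁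
  unfold IsSmoothVectorField
  convert! S with g
  · simp [F₁, F₂, F₃, fg, fv]
  · simp only [comp_apply, tangentMap, F₃, F₂, F₁, fg, fv]
    rw [mfderiv_prod_eq_add_apply ((contMDiff_mul I ∞).mdifferentiableAt (by simp))]
    exact (right_eq_add (M := E)).mpr (map_zero (mfderiv I I (fun z : G ↦ z * 1) g))

theorem leftPushforward_mulInvariantVectorField (σ : G) (v : GroupLieAlgebra I G) :
    leftPushforward σ (mulInvariantVectorField v) = mulInvariantVectorField (I := I) v :=
  mpullback_mulInvariantVectorField σ⁻¹ v

namespace CovariantDerivative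

variable {cov : CovariantDerivative I E (TangentSpace I : G → Type _)}

/-- A left-invariant connection preserves left-invariant vector fields. -/
theorem IsLeftInvariant.along_mulInvariantVectorField (hcov : cov.IsLeftInvariant)
    (v w : GroupLieAlgebra I G) :
    cov.along (mulInvariantVectorField v) (mulInvariantVectorField w) =
      mulInvariantVectorField
        (cov.along (mulInvariantVectorField v) (mulInvariantVectorField w) 1) := by
  ext g
  -- With `σ = g⁻¹` the outer pushforward is by `g`, so its value at `g` depends only on the value
  -- of the field at `1`.
  have h := hcov g⁻¹ _ _ (isSmoothVectorField_mulInvariantVectorField v)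
    (isSmoothVectorField_mulInvariantVectorField w)
  rw [leftPushforward_mulInvariantVectorField, leftPushforward_mulInvariantVectorField,
    inv_inv] at h
  rw [mulInvariantVectorField_eq_mpullback]
  exact (congrFun h g).symm

variable (cov) in
/-- The product `(v, w) ↦ (∇_v w)(1)` on the Lie algebra of a Lie group induced by a connection,
where `v` and `w` are extended to left-invariant vector fields. -/
noncomputable def invariantProduct :
    GroupLieAlgebra I G →ₗ[ℝ] GroupLieAlgebra I G →ₗ[ℝ] GroupLieAlgebra I G :=
  LinearMap.flip
    { toFun := fun w ↦ (cov (mulInvariantVectorField w) 1).toLinearMap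
      map_add' := fun w w' ↦ by
        rw [mulInvariantVectorField_add, cov.isCovariantDerivativeOnUniv.add
          (mdifferentiableAt_mulInvariantVectorField w)
          (mdifferentiableAt_mulInvariantVectorField w')]
        rfl
      map_smul' := fun c w ↦ by
        rw [mulInvariantVectorField_smul, cov.isCovariantDerivativeOnUniv.smul_const c
          (mdifferentiableAt_mulInvariantVectorField w)]
        rfl }

theorem along_mulInvariantVectorField_one (v w : GroupLieAlgebra I G) :
    cov.along (mulInvariantVectorField v) (mulInvariantVectorField w) 1 =
      cov.invariantProduct v w := by
  change cov _ 1 (mulInvariantVectorField v 1) = cov _ 1 v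
  rw [mulInvariantVectorField_apply_one]

variable [FiniteDimensional ℝ E]

theorem IsFlatAffine.invariantProduct_sub_swap (hcov : cov.IsFlatAffine)
    (v w : GroupLieAlgebra I G) :
    cov.invariantProduct v w - cov.invariantProduct w v = ⁅v, w⁆ := by
  rw [GroupLieAlgebra.bracket_def, ← cov.torsion_eq_zero_iff.mp hcov.torsion_eq_zero
    (mdifferentiableAt_mulInvariantVectorField v) (mdifferentiableAt_mulInvariantVectorField w),
    ← along_mulInvariantVectorField_one, ← along_mulInvariantVectorField_one]
  rfl

/-- Left invariance is what makes the inner derivatives in the curvature left-invariant fields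
again, so that iterated derivatives at `1` become iterated products. -/
theorem IsFlatAffine.invariantProduct_lie (hflat : cov.IsFlatAffine) (hinv : cov.IsLeftInvariant)
    (u v w : GroupLieAlgebra I G) :
    cov.invariantProduct ⁅u, v⁆ w =
      cov.invariantProduct u (cov.invariantProduct v w) -
        cov.invariantProduct v (cov.invariantProduct u w) := by
  have h := congrFun (hflat.curvature_eq_zero _ _ _ (isSmoothVectorField_mulInvariantVectorField u)
    (isSmoothVectorField_mulInvariantVectorField v)
    (isSmoothVectorField_mulInvariantVectorField w)) 1
  rw [curvature, ← mulInvariantVector_mlieBracket, ← GroupLieAlgebra.bracket_def,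
    hinv.along_mulInvariantVectorField v w, hinv.along_mulInvariantVectorField u w] at h
  simp only [Pi.sub_apply, along_mulInvariantVectorField_one] at h
  exact (sub_eq_zero.mp h).symm

end CovariantDerivative

end LieGroup

theorem theorem3 {E : Type*} [NormedAddCommGroup E] [NormedSpace ℝ E] [FiniteDimensional ℝ E]
    [Nontrivial E]
    {G : Type*} [TopologicalSpace G] [ChartedSpace E G] [Group G] [LieGroup 𝓘(ℝ, E) ∞ G]
    (hG : IsSemisimpleLieGroup 𝓘(ℝ, E) G) :
    ¬ ∃ cov : CovariantDerivative 𝓘(ℝ, E) E (TangentSpace 𝓘(ℝ, E) : G → Type _),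
      cov.IsLeftInvariant ∧ cov.IsFlatAffine := by
  rintro ⟨cov, hinv, hflat⟩
  have : LieAlgebra.IsSemisimple ℝ (GroupLieAlgebra 𝓘(ℝ, E) G) := hG
  have : Nontrivial (GroupLieAlgebra 𝓘(ℝ, E) G) := ‹Nontrivial E›
  have : FiniteDimensional ℝ (GroupLieAlgebra 𝓘(ℝ, E) G) := ‹FiniteDimensional ℝ E›
  exact LieAlgebra.not_exists_leftSymmetric_product cov.invariantProduct
    (hflat.invariantProduct_lie hinv) hflat.invariantProduct_sub_swap
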